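/- **Theorem 1.2 (Inductive machinery).** Let $k$ be a commutative Noetherian ring, and let $\mathcal C$ be a $k$-linear category whose objects are parameterized by the nonnegative integers, which is locally finite (each $\mathcal C(r,s)$ is a finitely generated $k$-module) and directed ($\mathcal C(r,s)=0$ whenever $r>s$). A $\mathcal C$-module is a covariant $k$-linear functor $V$ from $\mathcal C$ to the category of $k$-modules; write $M(s)=\mathcal C(s,-)$. A $\mathcal C$-module $V$ is *generated in degrees $\leqslant d$* if the only submodule of $V$ containing $V_r$ for all objects $r\leqslant d$ is $V$ itself (for $d=-1$ this means $V=0$), and *finitely generated* if $V$ contains a finite set such that the only submodule of $V$ containing this set is $V$. A finitely generated $\mathcal C$-module $V$ is *finitely presented* if it has a projective resolution $\cdots\to P^2\to P^1\to P^0\to V\to 0$ with $P^0$ and $P^1$ finitely generated. Let $\iota:\mathcal C\to\mathcal C$ be a faithful $k$-linear functor with $\iota(s)=s+1$ for every $s\geqslant 0$, and let $S=\iota^*$ be the pull-back functor on $\mathcal C$-modules, $V\mapsto V\circ\iota$. Suppose that $S$ is a generic shift functor, that is, that there is a natural transformation $\mu:\mathrm{Id}\to S$ such that for every $s\geqslant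 0$ the map $\mu_{M(s)}:M(s)\to SM(s)$ is injective with cokernel generated in degrees $\leqslant s-1$. Fix such a $\mu$ and, for a $\mathcal C$-module $V$, let $KV$ and $DV$ be the kernel and the cokernel of $\mu_V:V\to SV$. Suppose that $SM(s)$ is finitely presented for every $s\geqslant 0$. Let (P) be a property of $\mathcal C$-modules (an arbitrary predicate on $\mathcal C$-modules) which the zero $\mathcal C$-module has. Then every finitely generated $\mathcal C$-module has property (P) if and only if the following three conditions all hold: - (C1) (P) is $S$-dominant on finitely generated modules: for every finitely generated $\mathcal C$-module $V$, if $SV$ has property (P), then $V$ has property (P). - (C2) (P) is $D$-predominant on finitely generated modules: for every finitely generated $\mathcal C$-module $V$, if $DV$ has property (P) and $KV=0$, then $V$ has property (P). - (C3) In every short exact sequence $0\to V'\to V\to V''\to 0$ of finitely generated $\mathcal C$-modules, if $V'$ and $V''$ have property (P), then $V$ has property (P). -/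

import Mathlib

open CategoryTheory

universe w v u

section CMod

variable (k : Type w) [CommRing k] (C : Type u) [Category.{v} C] [Preadditive C] [Linear k C]

/-- The category of `C`-modules: covariant `k`-linear functors from the `k`-linear category `C`
to the category of `k`-modules, with natural transformations as morphisms. -/
abbrev CMod : Type (max w u (v + 1)) :=
  ObjectProperty.FullSubcategory
    (fun F : C ⥤ ModuleCat.{v} k => F.Additive ∧ Functor.Linear k F)

end CMod

namespace CMod

variable {k : Type w} [CommRing k] {C : Type u} [Category.{v} C] [Preadditive C] [Linear k C]

/-- The `k`-linear map `V_X → V_Y` by which a morphism `f : X ⟶ Y` of `C` acts on `V`. -/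
abbrev act (V : CMod k C) {X Y : C} (f : X ⟶ Y) : V.obj.obj X →ₗ[k] V.obj.obj Y :=
  (V.obj.map f).hom

/-- The `k`-linear component at `X` of a morphism of `C`-modules. -/
abbrev comp {V W : CMod k C} (φ : V ⟶ W) (X : C) : V.obj.obj X →ₗ[k] W.obj.obj X :=
  (φ.hom.app X).hom

lemma comp_act {V W : CMod k C} (φ : V ⟶ W) {X Y : C} (f : X ⟶ Y) (x : V.obj.obj X) :
    comp φ Y (V.act f x) = W.act f (comp φ X x) := by
  have h := φ.hom.naturality f
  exact congrArg (fun g => g.hom x) h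

variable (k) in
/-- The representable `C`-module `M(s) = C(s, -)`. -/
def M (s : C) : CMod k C where
  obj := (linearCoyoneda k C).obj (Opposite.op s)
  property := ⟨inferInstance, ⟨fun f r => by
    ext g
    exact Linear.comp_smul _ _ _ g r f⟩⟩

/-- A `C`-submodule of `V`. -/
@[ext]
structure Sub (V : CMod k C) where
  /-- the part of the submodule at each object -/
  carrier : ∀ X : C, Submodule k (V.obj.obj X)
  act_mem : ∀ {X Y : C} (f : X ⟶ Y) {x : V.obj.obj X}, x ∈ carrier X → V.act f x ∈ carrier Y

/-- `V` contains a finite set such that the only submodule of `V` containing it is `V`. -/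
def FinitelyGenerated (V : CMod k C) : Prop :=
  ∃ T : Set (Σ X : C, V.obj.obj X), T.Finite ∧
    ∀ N : Sub V, (∀ x ∈ T, x.2 ∈ N.carrier x.1) → ∀ X, N.carrier X = ⊤

/-- `V` is generated in degrees `≤ d`: the only submodule of `V` containing all the `V_X` with
`deg X ≤ d` is `V`. Here `deg` numbers the objects; for `d = -1` this says that `V = 0`. -/
def GeneratedInDegreesLE (deg : C ≃ ℕ) (V : CMod k C) (d : ℤ) : Prop :=
  ∀ N : Sub V, (∀ X, (deg X : ℤ) ≤ d → N.carrier X = ⊤) → ∀ X, N.carrier X = ⊤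

/-- Exactness of `U → V → W` at `V`. -/
def ExactAt {U V W : CMod k C} (f : U ⟶ V) (g : V ⟶ W) : Prop :=
  ∀ X, LinearMap.range (comp f X) = LinearMap.ker (comp g X)

/-- `0 → U → V → W → 0` is a short exact sequence. -/
structure IsShortExact {U V W : CMod k C} (f : U ⟶ V) (g : V ⟶ W) : Prop where
  injective : ∀ X, Function.Injective (comp f X)
  exact : ExactAt f g
  surjective : ∀ X, Function.Surjective (comp g X)

/-- `V` is finitely generated and has a projective resolution `⋯ → P 1 → P 0 → V → 0` with
`P i` finitely generated for `i ≤ n`. -/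
def NFinitelyPresented (n : ℕ) (V : CMod k C) : Prop :=
  V.FinitelyGenerated ∧
  ∃ (P : ℕ → CMod k C) (d : ∀ i, P (i + 1) ⟶ P i) (ε : P 0 ⟶ V),
    (∀ i, Projective (P i)) ∧
    (∀ X, Function.Surjective (comp ε X)) ∧
    ExactAt (d 0) ε ∧
    (∀ i, ExactAt (d (i + 1)) (d i)) ∧
    ∀ i ≤ n, (P i).FinitelyGenerated

/-- Finitely presented: there is a projective resolution whose terms in degrees `0` and `1` are
finitely generated. -/
def FinitelyPresented (V : CMod k C) : Prop :=
  NFinitelyPresented 1 V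

/-- The pull-back functor `S = ι^*` on `C`-modules induced by a `k`-linear functor `ι : C ⥤ C`. -/
def shift (k : Type w) [CommRing k] {C : Type u} [Category.{v} C] [Preadditive C] [Linear k C]
    (ι : C ⥤ C) [ι.Additive] [Functor.Linear k ι] : CMod k C ⥤ CMod k C where
  obj V :=
    { obj := ι ⋙ V.obj
      property := by
        obtain ⟨_, _⟩ := V.property
        exact ⟨inferInstance, inferInstance⟩ }
  map φ := ObjectProperty.homMk (Functor.whiskerLeft ι φ.hom)

section KD

variable {S : CMod k C ⥤ CMod k C} (μ : 𝟭 (CMod k C) ⟶ S)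

/-- `KV`, the kernel of `μ_V : V → SV`. -/
def K (V : CMod k C) : Sub V where
  carrier X := LinearMap.ker (comp (μ.app V) X)
  act_mem {X Y} f {x} hx := by
    rw [LinearMap.mem_ker] at hx ⊢
    have h := comp_act (μ.app V) f x
    rw [hx, map_zero] at h
    exact h

/-- The range of the component of `μ_V : V → SV` at `X`. -/
abbrev rangeAt (V : CMod k C) (X : C) : Submodule k ((S.obj V).obj.obj X) :=
  LinearMap.range (comp (μ.app V) X)

lemma rangeAt_le_comap_act (V : CMod k C) {X Y : C} (f : X ⟶ Y) :
    rangeAt μ V X ≤ (rangeAt μ V Y).comap ((S.obj V).act f) := by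
  rintro _ ⟨x, rfl⟩
  exact ⟨V.act f x, comp_act (μ.app V) f x⟩

lemma rangeAt_le_comap_map {V W : CMod k C} (φ : V ⟶ W) (X : C) :
    rangeAt μ V X ≤ (rangeAt μ W X).comap (comp (S.map φ) X) := by
  rintro _ ⟨x, rfl⟩
  refine ⟨comp φ X x, ?_⟩
  have h := μ.naturality φ
  exact congrArg (fun g => comp g X x) h

/-- The functor `D`, sending `V` to the cokernel `DV` of `μ_V : V → SV`. -/
def D : CMod k C ⥤ CMod k C where
  obj V :=
    { obj :=
        { obj := fun X => ModuleCat.of k ((S.obj V).obj.obj X ⧸ rangeAt μ V X)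
          map := fun {X Y} f => ModuleCat.ofHom
            (Submodule.mapQ (rangeAt μ V X) (rangeAt μ V Y) ((S.obj V).act f)
              (rangeAt_le_comap_act μ V f))
          map_id := fun X => by
            ext x
            simp [act]
          map_comp := fun f g => by
            ext x
            simp [act] }
      property := by
        obtain ⟨_, _⟩ := (S.obj V).property
        refine ⟨⟨fun {X Y f g} => ?_⟩, ⟨fun {X Y} f r => ?_⟩⟩
        · ext x
          simp [act, Functor.map_add]
        · ext x
          simp [act, Functor.map_smul] }
  map {V W} φ := ObjectProperty.homMk
    { app := fun X => ModuleCat.ofHom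
        (Submodule.mapQ (rangeAt μ V X) (rangeAt μ W X) (comp (S.map φ) X)
          (rangeAt_le_comap_map μ φ X))
      naturality := fun X Y f => by
        ext x
        exact congrArg (Submodule.Quotient.mk (p := rangeAt μ W Y))
          (comp_act (S.map φ) f x) }
  map_id V := by
    ext X x
    simp [comp]
  map_comp φ ψ := by
    ext X x
    simp [comp]

/-- `S` is generic, as witnessed by `μ : Id → S`: for every `s`, the map `M(s) → S M(s)` is
injective and its cokernel is generated in degrees `≤ s - 1`. -/
structure IsGeneric (deg : C ≃ ℕ) : Prop where
  injective : ∀ s X : C, Function.Injective (comp (μ.app (M k s)) X)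
  generated : ∀ s : C, GeneratedInDegreesLE deg ((D μ).obj (M k s)) ((deg s : ℤ) - 1)

/-- The property `P` is `F`-predominant on the class `T` of `C`-modules. -/
def IsPredominantOn (T : CMod k C → Prop) (F : CMod k C ⥤ CMod k C) (P : CMod k C → Prop) : Prop :=
  ∀ V, T V → P (F.obj V) → (∀ X, (K μ V).carrier X = ⊥) → P V

end KD

/-- The property `P` is `F`-dominant on the class `T` of `C`-modules. -/
def IsDominantOn (T : CMod k C → Prop) (F : CMod k C ⥤ CMod k C) (P : CMod k C → Prop) : Prop :=
  ∀ V, T V → P (F.obj V) → P V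

/-- The property `P` is closed under extensions among finitely generated `C`-modules. -/
def ClosedUnderExtensions (P : CMod k C → Prop) : Prop :=
  ∀ (U V W : CMod k C) (f : U ⟶ V) (g : V ⟶ W), IsShortExact f g →
    U.FinitelyGenerated → V.FinitelyGenerated → W.FinitelyGenerated → P U → P W → P V

end CMod

namespace CMod

variable {k : Type w} [CommRing k] {C : Type u} [Category.{v} C] [Preadditive C] [Linear k C]

/-! Sufficiency of the three conditions is an induction on a bound `d` for the degrees of generators
of `V`. Since `D` lowers this bound (`genLT_D`), `DV` has (P) by induction. If `KV = 0`, then (C2)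
finishes. Otherwise `SV` is an extension of `DV` by the image of `μ_V`, which is `V / KV`; once `V /
KV` has (P), so does `SV` by (C3), hence `V` by (C1).

Passing from `V` to `V / KV` must therefore reach a zero kernel after finitely many steps. For a
submodule `N`, let `N.sat μ` be the preimage under `μ_V` of the shift of `N`. Then `KV` is the
saturation of `0`, and replacing `V` by `V / KV` shortens the chain of iterated saturations of `0`
by one (`sat_iterate_toRangeSub`). The chain stabilizes because `V` is Noetherian, which follows
from a Hilbert basis argument: if `DV` is Noetherian, so is `V` (`isNoeth_of_isNoeth_D`). -/

lemma act_id (V : CMod k C) (X : C) (x : V.obj.obj X) : V.act (𝟙 X) x = x := by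
  simp [act]

lemma act_comp (V : CMod k C) {X Y Z : C} (f : X ⟶ Y) (g : Y ⟶ Z) (x : V.obj.obj X) :
    V.act (f ≫ g) x = V.act g (V.act f x) := by
  simp [act]

/-- The morphism `M(X) → V` sending the identity of `X` to `x`. -/
def ofElement {V : CMod k C} {X : C} (x : V.obj.obj X) : M k X ⟶ V :=
  ObjectProperty.homMk
    { app := fun Y => ModuleCat.ofHom
        { toFun := fun f : X ⟶ Y => V.act f x
          map_add' := fun f g => by
            have := V.property.1
            simp [act, Functor.map_add]
          map_smul' := fun r f => by
            have := V.property.2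
            simp [act, Functor.map_smul] }
      naturality := fun Y Z g => by
        ext f
        exact act_comp V f g x }

lemma comp_ofElement {V : CMod k C} {X Y : C} (x : V.obj.obj X) (f : X ⟶ Y) :
    comp (ofElement x) Y f = V.act f x := rfl

/-- A zero object is zero at every object of `C`. -/
lemma eq_zero_of_isZero {Z : CMod k C} (hZ : Limits.IsZero Z) {X : C} (x : Z.obj.obj X) :
    x = 0 := by
  have h := hZ.eq_of_tgt (ofElement x) (ofElement (0 : Z.obj.obj X))
  have h' := congrArg (fun φ => comp φ X (𝟙 X)) h
  simpa [comp_ofElement, act_id] using h'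

/-! ### Submodules and generation in bounded degrees. -/

namespace Sub

variable {V W : CMod k C}

instance : LE (Sub V) := ⟨fun N N' => ∀ X, N.carrier X ≤ N'.carrier X⟩

instance : Top (Sub V) := ⟨⟨fun _ => ⊤, fun _ _ _ => trivial⟩⟩

instance : Bot (Sub V) := ⟨⟨fun _ => ⊥, fun f x hx => by
  rw [Submodule.mem_bot] at hx ⊢
  rw [hx, map_zero]⟩⟩

instance : Min (Sub V) := ⟨fun N N' => ⟨fun X => N.carrier X ⊓ N'.carrier X,
  fun f _ hx => ⟨N.act_mem f hx.1, N'.act_mem f hx.2⟩⟩⟩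

instance : SupSet (Sub V) := ⟨fun A => ⟨fun X => ⨆ N ∈ A, N.carrier X, fun {X Y} f x hx => by
  have h : (⨆ N ∈ A, N.carrier X) ≤ (⨆ N ∈ A, N.carrier Y).comap (V.act f) :=
    iSup₂_le fun N hN y hy =>
      (le_iSup₂ (f := fun (N : Sub V) (_ : N ∈ A) => N.carrier Y) N hN) (N.act_mem f hy)
  exact h hx⟩⟩

lemma carrier_iSup {α : Sort*} (N : α → Sub V) (X : C) :
    (⨆ i, N i).carrier X = ⨆ i, (N i).carrier X := by
  change (⨆ N' ∈ Set.range N, N'.carrier X) = _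
  rw [iSup_range]

/-- The preimage of a submodule. -/
def comap (φ : V ⟶ W) (N : Sub W) : Sub V where
  carrier X := (N.carrier X).comap (CMod.comp φ X)
  act_mem f x hx := by
    rw [Submodule.mem_comap] at hx ⊢
    rw [comp_act]
    exact N.act_mem f hx

/-- The image of a submodule. -/
def map (φ : V ⟶ W) (N : Sub V) : Sub W where
  carrier X := (N.carrier X).map (CMod.comp φ X)
  act_mem f x hx := by
    obtain ⟨y, hy, rfl⟩ := hx
    exact ⟨_, N.act_mem f hy, comp_act φ f y⟩

/-- A submodule, seen as a `C`-module. -/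
def toMod (N : Sub V) : CMod k C where
  obj :=
    { obj := fun X => ModuleCat.of k (N.carrier X)
      map := fun {X Y} f => ModuleCat.ofHom
        ((V.act f).restrict (p := N.carrier X) (q := N.carrier Y) fun _ hx => N.act_mem f hx)
      map_id := fun X => by
        ext x
        exact act_id V X x.1
      map_comp := fun f g => by
        ext x
        exact act_comp V f g x.1 }
  property := by
    obtain ⟨_, _⟩ := V.property
    refine ⟨⟨fun {X Y f g} => ?_⟩, ⟨fun {X Y} f r => ?_⟩⟩
    · ext x
      change V.act (f + g) x.1 = V.act f x.1 + V.act g x.1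
      simp [act, Functor.map_add]
    · ext x
      change V.act (r • f) x.1 = r • V.act f x.1
      simp [act, Functor.map_smul]

/-- The inclusion of a submodule. -/
def incl (N : Sub V) : N.toMod ⟶ V :=
  ObjectProperty.homMk { app := fun X => ModuleCat.ofHom (N.carrier X).subtype }

/-- The corestriction of a morphism to a submodule that contains its image. -/
def lift (N : Sub W) (φ : V ⟶ W) (h : ∀ X x, CMod.comp φ X x ∈ N.carrier X) : V ⟶ N.toMod :=
  ObjectProperty.homMk
    { app := fun X => ModuleCat.ofHom ((CMod.comp φ X).codRestrict (N.carrier X) (h X))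
      naturality := fun X Y f => by
        ext x
        exact Subtype.ext (comp_act φ f x) }

/-- The submodule `N` is generated by its elements of degree less than `d`. -/
def GenLT (deg : C ≃ ℕ) (N : Sub V) (d : ℕ) : Prop :=
  ∀ N' : Sub V, (∀ X, deg X < d → N.carrier X ≤ N'.carrier X) → N ≤ N'

variable {deg : C ≃ ℕ}

/-- All submodules of `V` are generated in bounded degrees. -/
def IsNoeth (deg : C ≃ ℕ) (V : CMod k C) : Prop :=
  ∀ N : Sub V, ∃ d, N.GenLT deg d

/-- The image of a `C`-module generated in degrees less than `d` is generated in these degrees. -/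
lemma GenLT.of_surjective (φ : V ⟶ W) (hφ : ∀ X, Function.Surjective (CMod.comp φ X)) {d : ℕ}
    (h : (⊤ : Sub V).GenLT deg d) : (⊤ : Sub W).GenLT deg d := by
  intro N hN X x _
  obtain ⟨y, rfl⟩ := hφ X x
  exact h (N.comap φ) (fun Y hY z _ => hN Y hY (Submodule.mem_top)) X (Submodule.mem_top (x := y))

/-- An increasing sequence of submodules whose union is generated in bounded degrees
stabilizes. -/
lemma exists_iSup_le (hV : ∀ X, IsNoetherian k (V.obj.obj X)) (N : ℕ → Sub V)
    (hN : ∀ i, N i ≤ N (i + 1)) {d : ℕ} (hd : (⨆ i, N i).GenLT deg d) :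
    ∃ n, (⨆ i, N i) ≤ N n := by
  have hmono : ∀ X, Monotone fun i => (N i).carrier X :=
    fun X => monotone_nat_of_le_succ fun i => hN i X
  have hstab : ∀ X, ∃ n, ∀ m, n ≤ m → (N n).carrier X = (N m).carrier X := fun X =>
    monotone_stabilizes_iff_noetherian.2 (hV X) ⟨_, hmono X⟩
  choose n hn using hstab
  -- Only finitely many objects have degree below `d`, so their stabilization indices have a
  -- maximum.
  refine ⟨(Finset.range d).sup fun i => n (deg.symm i), hd _ fun X hX => ?_⟩
  have hle : n X ≤ (Finset.range d).sup fun i => n (deg.symm i) := by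
    simpa using Finset.le_sup (f := fun i => n (deg.symm i)) (Finset.mem_range.2 hX)
  rw [carrier_iSup, ← hn X _ hle]
  refine iSup_le fun i => ?_
  rw [hn X _ (le_max_left (n X) i)]
  exact hmono X (le_max_right (n X) i)

end Sub

/-! ### Finite generation versus generation in bounded degrees. -/

section FinitelyGenerated

variable {deg : C ≃ ℕ} {V W : CMod k C}

lemma FinitelyGenerated.exists_genLT (deg : C ≃ ℕ) (h : V.FinitelyGenerated) :
    ∃ d, (⊤ : Sub V).GenLT deg d := by
  obtain ⟨T, hT, h⟩ := h
  obtain ⟨b, hb⟩ := (hT.image fun t => deg t.1).bddAbove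
  refine ⟨b + 1, fun N hN X => (h N (fun t ht => hN _ ?_ Submodule.mem_top) X).ge⟩
  exact Nat.lt_succ_of_le (hb ⟨t, ht, rfl⟩)

/-- A `C`-module generated in degrees less than `d` and finitely generated at every object is
finitely generated. -/
lemma Sub.GenLT.finitelyGenerated (hV : ∀ X, Module.Finite k (V.obj.obj X)) {d : ℕ}
    (h : (⊤ : Sub V).GenLT deg d) : V.FinitelyGenerated := by
  choose s hs using fun X => (hV X).fg_top
  refine ⟨⋃ i ∈ Finset.range d, Sigma.mk (deg.symm i) '' (s (deg.symm i) : Set _), ?_, ?_⟩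
  · exact (Finset.range d).finite_toSet.biUnion fun i _ => (Finset.finite_toSet _).image _
  · refine fun N hN X => top_le_iff.1 (h N (fun Y hY => ?_) X)
    change ⊤ ≤ _
    rw [← hs Y, Submodule.span_le]
    intro x hx
    refine hN ⟨Y, x⟩ ?_
    simp only [Set.mem_iUnion]
    obtain ⟨i, rfl⟩ := deg.symm.surjective Y
    exact ⟨i, by simpa using hY, x, hx, rfl⟩

lemma mem_iSup_ofElement (p : C → Prop) {X : C} {x : V.obj.obj X} (hX : p X) :
    x ∈ (⨆ t : {t : Σ X : C, V.obj.obj X // p t.1},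
      Sub.map (ofElement t.1.2) (⊤ : Sub (M k t.1.1))).carrier X := by
  rw [Sub.carrier_iSup]
  exact Submodule.mem_iSup_of_mem ⟨⟨X, x⟩, hX⟩ ⟨𝟙 X, trivial, act_id V X x⟩

lemma FinitelyGenerated.finite_obj [IsNoetherianRing k]
    (locally_finite : ∀ X Y : C, Module.Finite k (X ⟶ Y)) (h : V.FinitelyGenerated) (X : C) :
    Module.Finite k (V.obj.obj X) := by
  obtain ⟨T, hT, h⟩ := h
  have := hT.to_subtype
  rw [Module.finite_def, ← h (⨆ t : T, Sub.map (ofElement t.1.2) (⊤ : Sub (M k t.1.1))) ?_ X,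
    Sub.carrier_iSup]
  · exact Submodule.fg_iSup _ fun t => Submodule.FG.map _ (locally_finite t.1.1 X).fg_top
  · intro t ht
    rw [Sub.carrier_iSup]
    exact Submodule.mem_iSup_of_mem ⟨t, ht⟩ ⟨𝟙 t.1, trivial, act_id V t.1 t.2⟩

end FinitelyGenerated

lemma exists_obj_eq {C : Type u} [Category.{v} C] {deg : C ≃ ℕ} {ι : C ⥤ C}
    (hι : ∀ X : C, deg (ι.obj X) = deg X + 1) {Y : C} {n : ℕ} (hY : deg Y = n + 1) :
    ∃ X, ι.obj X = Y ∧ deg X = n :=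
  ⟨deg.symm n, deg.injective (by rw [hι, hY, deg.apply_symm_apply]), deg.apply_symm_apply n⟩

/-! ### The shift, its cokernel `D`, and saturation. -/

section Shift

variable {ι : C ⥤ C} [ι.Additive] [Functor.Linear k ι] (μ : 𝟭 (CMod k C) ⟶ CMod.shift k ι)
  {V W : CMod k C}

/-- The morphism `X ⟶ ι X` through which `μ` acts on every `C`-module. -/
def eta (X : C) : X ⟶ ι.obj X :=
  comp (μ.app (M k X)) X (𝟙 X)

/-- Yoneda: naturality of `μ` along the morphism `M(X) → V` given by `x` reduces the claim to the
identity of `X`. -/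
lemma comp_app (X : C) (x : V.obj.obj X) : comp (μ.app V) X x = V.act (eta μ X) x := by
  have h := congrArg (fun φ => comp φ X (𝟙 X)) (μ.naturality (ofElement x))
  exact Eq.trans (congrArg (comp (μ.app V) X) (act_id V X x).symm) h

namespace Sub

variable (ι) in
/-- The shift of a submodule. -/
def pullback (N : Sub V) : Sub ((CMod.shift k ι).obj V) where
  carrier X := N.carrier (ι.obj X)
  act_mem f _ hx := N.act_mem (ι.map f) hx

/-- The submodule of all elements that `μ` sends into the shift of `N`. -/
def sat (N : Sub V) : Sub V where
  carrier X := (N.carrier (ι.obj X)).comap (V.act (eta μ X))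
  act_mem {X Y} f {x} hx := by
    have h : V.act (eta μ Y) (V.act f x) = V.act (ι.map f) (V.act (eta μ X) x) := by
      rw [← comp_app, ← comp_app]
      exact comp_act (μ.app V) f x
    rw [Submodule.mem_comap] at hx ⊢
    rw [h]
    exact N.act_mem _ hx

lemma le_sat (N : Sub V) : N ≤ N.sat μ :=
  fun X _ hx => N.act_mem (eta μ X) hx

end Sub

/-- The projection `SV → DV`. -/
def toD (V : CMod k C) : (shift k ι).obj V ⟶ (D μ).obj V :=
  ObjectProperty.homMk { app := fun X => ModuleCat.ofHom (rangeAt μ V X).mkQ }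

lemma comp_toD_surjective (X : C) : Function.Surjective (comp (toD μ V) X) :=
  (rangeAt μ V X).mkQ_surjective

lemma comp_toD_eq_iff {X : C} {x y : ((shift k ι).obj V).obj.obj X} :
    comp (toD μ V) X x = comp (toD μ V) X y ↔ x - y ∈ rangeAt μ V X :=
  Submodule.Quotient.eq _

/-- The image of `μ`. -/
def rangeSub (V : CMod k C) : Sub ((shift k ι).obj V) where
  carrier := rangeAt μ V
  act_mem f _ hx := rangeAt_le_comap_act μ V f hx

lemma isShortExact_rangeSub (V : CMod k C) :
    IsShortExact (rangeSub μ V).incl (toD μ V) where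
  injective X := Subtype.val_injective (p := (· ∈ rangeAt μ V X))
  exact X := (Submodule.range_subtype (rangeAt μ V X)).trans (Submodule.ker_mkQ _).symm
  surjective := comp_toD_surjective μ

/-- The corestriction of `μ` to its image. -/
def toRangeSub (V : CMod k C) : V ⟶ (rangeSub μ V).toMod :=
  (rangeSub μ V).lift (μ.app V) fun _ x => ⟨x, rfl⟩

lemma comp_toRangeSub_surjective (X : C) : Function.Surjective (comp (toRangeSub μ V) X) := by
  rintro ⟨_, x, rfl⟩
  exact ⟨x, rfl⟩

variable {deg : C ≃ ℕ}

/-- If `S` is generic, then `D` lowers the degrees of generators. -/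
lemma IsGeneric.genLT_D (hμ : IsGeneric μ deg) {d : ℕ} (h : (⊤ : Sub V).GenLT deg (d + 1)) :
    (⊤ : Sub ((D μ).obj V)).GenLT deg d := by
  intro N hN X z _
  obtain ⟨v, rfl⟩ := comp_toD_surjective μ X z
  -- Lift to `SV`: the lift is a sum of images of arrows `Y ⟶ ι.obj X` with `deg Y ≤ d`. Each arrow
  -- is an element of `S M(Y)` at `X`, and `D M(Y)` is generated in degrees `≤ deg Y - 1 < d`.
  have hv := h _ (fun Y hY y _ => mem_iSup_ofElement (fun Y => deg Y < d + 1) hY) (ι.obj X)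
    (Submodule.mem_top (x := v))
  rw [Sub.carrier_iSup] at hv
  have hle := iSup_le (a := (N.comap (toD μ V)).carrier X) (fun t => ?_) hv
  · exact hle
  · obtain ⟨⟨Y, x⟩, hY⟩ := t
    rintro _ ⟨f, -, rfl⟩
    have htop := hμ.generated Y (N.comap ((D μ).map (ofElement x)))
      (fun Z hZ => top_le_iff.1 fun y _ => hN Z (by simp only at hY; omega) Submodule.mem_top) X
    have hmem : comp (toD μ (M k Y)) X f ∈ (N.comap ((D μ).map (ofElement x))).carrier X :=
      htop ▸ Submodule.mem_top
    exact hmem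

/-! ### Noetherianity. -/

/-- If `DV` is Noetherian, then, up to elements coming from lower degrees, a submodule of `V` is
generated in bounded degrees. -/
lemma Sub.exists_decomposition (hι : ∀ X : C, deg (ι.obj X) = deg X + 1)
    (hD : Sub.IsNoeth deg ((D μ).obj V)) (N : Sub V) :
    ∃ e, ∀ N' : Sub V, (∀ X, deg X < e + 1 → N.carrier X ≤ N'.carrier X) →
      ∀ X, ∀ x ∈ N.carrier (ι.obj X), ∃ y ∈ N'.carrier (ι.obj X),
        ∃ z ∈ (N.sat μ).carrier X, x = y + V.act (eta μ X) z := by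
  obtain ⟨e, he⟩ := hD (map (toD μ V) (N.pullback ι))
  refine ⟨e, fun N' hN' X x hx => ?_⟩
  -- Below degree `e`, `N` and `N ⊓ N'` have equal shifts, as `ι` raises degrees by one. So the
  -- class of `x` in `DV` is also that of some `y` in `N ⊓ N'`; then `x - y` lies in `N` and comes
  -- from some `z` under `μ`.
  obtain ⟨y, hy, hyx⟩ := he (map (toD μ V) ((N ⊓ N').pullback ι))
    (fun Y hY => Submodule.map_mono fun y hy => ⟨hy, hN' _ (by rw [hι]; omega) hy⟩) X
    ⟨x, hx, rfl⟩
  obtain ⟨z, hz⟩ := (comp_toD_eq_iff μ).1 hyx.symm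
  let y' : V.obj.obj (ι.obj X) := y
  have hz' : V.act (eta μ X) z = x - y' := (comp_app μ X z).symm.trans hz
  refine ⟨y, hy.2, z, ?_, ?_⟩
  · change V.act (eta μ X) z ∈ N.carrier (ι.obj X)
    rw [hz']
    exact sub_mem hx hy.1
  · exact sub_eq_iff_eq_add'.1 hz'.symm

/-- Here the element `z` of the decomposition lies in `N` itself, one degree lower, so induction on
the degree applies. -/
lemma Sub.exists_genLT_of_sat_le (hι : ∀ X : C, deg (ι.obj X) = deg X + 1)
    (hD : Sub.IsNoeth deg ((D μ).obj V)) {N : Sub V} (hN : N.sat μ ≤ N) :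
    ∃ d, N.GenLT deg d := by
  obtain ⟨e, he⟩ := N.exists_decomposition μ hι hD
  -- The bound is at least 1, which covers degree 0, the only degree that `ι` does not reach.
  refine ⟨e + 1, fun N' hN' => ?_⟩
  have key : ∀ n X, deg X = n → N.carrier X ≤ N'.carrier X := by
    intro n
    induction n with
    | zero => exact fun X hX => hN' X (by omega)
    | succ n ih =>
      intro Y hY x hx
      obtain ⟨X, rfl, hX⟩ := exists_obj_eq hι hY
      obtain ⟨y, hy, z, hz, rfl⟩ := he N' hN' X x hx
      exact add_mem hy (N'.le_sat μ X (ih X hX (hN X hz)))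
  exact fun X => key _ X rfl

/-- If `N'` contains `N` in degrees `≤ d`, then its saturation contains the generators of `N.sat μ`,
so the element `z` of the decomposition is sent into `N'`. -/
lemma Sub.exists_genLT_of_genLT_sat (hι : ∀ X : C, deg (ι.obj X) = deg X + 1)
    (hD : Sub.IsNoeth deg ((D μ).obj V)) {N : Sub V} {d : ℕ} (hN : (N.sat μ).GenLT deg d) :
    ∃ d, N.GenLT deg d := by
  obtain ⟨e, he⟩ := N.exists_decomposition μ hι hD
  refine ⟨max e d + 1, fun N' hN' Y x hx => ?_⟩
  have hsat : N.sat μ ≤ N'.sat μ := hN _ fun X hX y hy => hN' _ (by rw [hι]; omega) hy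
  cases hY : deg Y with
  | zero => exact hN' Y (by omega) hx
  | succ n =>
    obtain ⟨X, rfl, hX⟩ := exists_obj_eq hι hY
    obtain ⟨y, hy, z, hz, rfl⟩ := he N' (fun Z hZ => hN' Z (by omega)) X x hx
    exact add_mem hy (hsat X hz)

/-- An analogue of Hilbert's basis theorem: if `DV` is Noetherian, then so is `V`. -/
lemma isNoeth_of_isNoeth_D (hι : ∀ X : C, deg (ι.obj X) = deg X + 1)
    (hV : ∀ X, IsNoetherian k (V.obj.obj X)) (hD : Sub.IsNoeth deg ((D μ).obj V)) :
    Sub.IsNoeth deg V := by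
  intro N
  let F : ℕ → Sub V := fun i => (Sub.sat μ)^[i] N
  have hF : ∀ i, F (i + 1) = (F i).sat μ := fun i => Function.iterate_succ_apply' _ _ _
  have hmono : ∀ i, F i ≤ F (i + 1) := fun i => hF i ▸ (F i).le_sat μ
  -- The chain is directed, so an element sent into the union is already sent into some `F i`, and
  -- lies in `F (i + 1)`.
  have hunion : (⨆ i, F i).sat μ ≤ ⨆ i, F i := by
    intro X x hx
    have hx' : V.act (eta μ X) x ∈ (⨆ i, F i).carrier (ι.obj X) := hx
    rw [Sub.carrier_iSup, Submodule.mem_iSup_of_directed _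
      (monotone_nat_of_le_succ fun i => hmono i _).directed_le] at hx'
    obtain ⟨i, hi⟩ := hx'
    rw [Sub.carrier_iSup]
    refine Submodule.mem_iSup_of_mem (i + 1) ?_
    rw [hF]
    exact hi
  obtain ⟨d, hd⟩ := Sub.exists_genLT_of_sat_le μ hι hD hunion
  obtain ⟨n, hn⟩ := Sub.exists_iSup_le hV F hmono hd
  have hle : ∀ i X, (F i).carrier X ≤ (⨆ i, F i).carrier X := fun i X => by
    rw [Sub.carrier_iSup]
    exact le_iSup (fun i => (F i).carrier X) i
  have hgen : ∃ d, (F n).GenLT deg d :=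
    ⟨d, fun N' hN' X => (hle n X).trans (hd N' (fun Y hY => (hn Y).trans (hN' Y hY)) X)⟩
  -- Bounded generation descends from `F n` to `N`, one saturation at a time.
  have hdesc : ∀ n (N : Sub V), (∃ d, ((Sub.sat μ)^[n] N).GenLT deg d) → ∃ d, N.GenLT deg d := by
    intro n
    induction n with
    | zero => exact fun N h => h
    | succ n ih =>
      intro N h
      obtain ⟨e, he⟩ := ih (N.sat μ) h
      exact Sub.exists_genLT_of_genLT_sat μ hι hD he
  exact hdesc n N hgen

lemma finite_shift (hV : ∀ X, Module.Finite k (V.obj.obj X)) (X : C) :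
    Module.Finite k (((shift k ι).obj V).obj.obj X) :=
  hV (ι.obj X)

lemma finite_D (hV : ∀ X, Module.Finite k (V.obj.obj X)) (X : C) :
    Module.Finite k (((D μ).obj V).obj.obj X) :=
  have := finite_shift (ι := ι) hV X
  Module.Finite.of_surjective _ (comp_toD_surjective μ X)

/-- If `S` is generic, then the finitely generated modules are Noetherian. -/
lemma IsGeneric.isNoeth [IsNoetherianRing k] (hμ : IsGeneric μ deg)
    (hι : ∀ X : C, deg (ι.obj X) = deg X + 1) {d : ℕ}
    (hV : ∀ X, Module.Finite k (V.obj.obj X)) (h : (⊤ : Sub V).GenLT deg d) :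
    Sub.IsNoeth deg V := by
  induction d generalizing V with
  | zero =>
    exact fun N => ⟨0, fun N' _ X =>
      le_top.trans (h N' (fun Y hY => absurd hY (Nat.not_lt_zero _)) X)⟩
  | succ d ih =>
    have hV' : ∀ X, IsNoetherian k (V.obj.obj X) := fun X => have := hV X; inferInstance
    exact isNoeth_of_isNoeth_D μ hι hV' (ih (finite_D μ hV) (hμ.genLT_D μ h))

/-- If `S` is generic, then `S` preserves generation in degrees less than `d`. -/
lemma IsGeneric.genLT_shift (hμ : IsGeneric μ deg) {d : ℕ}
    (h : (⊤ : Sub V).GenLT deg (d + 1)) :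
    (⊤ : Sub ((shift k ι).obj V)).GenLT deg (d + 1) := by
  intro N hN X x _
  -- `SV` is an extension of `DV` by the image of `μ`, and both are generated in degrees `≤ d`.
  have hrange : ∀ y, comp (μ.app V) X y ∈ N.carrier X := fun y =>
    h (N.comap (μ.app V)) (fun Y hY z _ => hN Y hY Submodule.mem_top) X
      (Submodule.mem_top (x := y))
  obtain ⟨y, hy, hyx⟩ := hμ.genLT_D μ h (Sub.map (toD μ V) N)
    (fun Y hY z _ => by
      obtain ⟨v, rfl⟩ := comp_toD_surjective μ Y z
      exact ⟨v, hN Y (hY.trans d.lt_succ_self) Submodule.mem_top, rfl⟩) X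
    (Submodule.mem_top (x := comp (toD μ V) X x))
  obtain ⟨z, hz⟩ := (comp_toD_eq_iff μ).1 hyx.symm
  rw [← sub_add_cancel x y, ← hz]
  exact add_mem (hrange z) hy

lemma exists_sat_iterate_le (hV : ∀ X, IsNoetherian k (V.obj.obj X)) (h : Sub.IsNoeth deg V)
    (N : Sub V) : ∃ n, (Sub.sat μ)^[n + 1] N ≤ (Sub.sat μ)^[n] N := by
  obtain ⟨d, hd⟩ := h (⨆ i, (Sub.sat μ)^[i] N)
  obtain ⟨n, hn⟩ := Sub.exists_iSup_le hV (fun i => (Sub.sat μ)^[i] N)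
    (fun i => by
      rw [Function.iterate_succ_apply']
      exact Sub.le_sat μ _) hd
  refine ⟨n, fun X => le_trans ?_ (hn X)⟩
  rw [Sub.carrier_iSup]
  exact le_iSup (fun i => ((Sub.sat μ)^[i] N).carrier X) (n + 1)

lemma sat_comap (φ : V ⟶ W) (N : Sub W) : (N.comap φ).sat μ = (N.sat μ).comap φ := by
  ext X x
  change comp φ (ι.obj X) (V.act (eta μ X) x) ∈ N.carrier (ι.obj X) ↔ _
  rw [comp_act]
  rfl

lemma sat_iterate_comap (φ : V ⟶ W) (N : Sub W) (n : ℕ) :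
    (Sub.sat μ)^[n] (N.comap φ) = ((Sub.sat μ)^[n] N).comap φ := by
  induction n with
  | zero => rfl
  | succ n ih => rw [Function.iterate_succ_apply', ih, sat_comap, Function.iterate_succ_apply']

lemma comap_toRangeSub_bot : (⊥ : Sub (rangeSub μ V).toMod).comap (toRangeSub μ V) =
    (⊥ : Sub V).sat μ := by
  ext X x
  change _ ↔ V.act (eta μ X) x = 0
  rw [← comp_app]
  exact (Submodule.mk_eq_zero _ _ : (⟨comp (μ.app V) X x, _⟩ : rangeAt μ V X) = 0 ↔ _)

/-- The kernel of `V → V / KV` is `⊥.sat μ`, so the `m`-th saturation of `0` in the image pulls back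
to the `(m + 1)`-st in `V`; surjectivity lets the inclusion descend. -/
lemma sat_iterate_toRangeSub {n : ℕ}
    (h : (Sub.sat μ)^[n + 2] (⊥ : Sub V) ≤ (Sub.sat μ)^[n + 1] ⊥) :
    (Sub.sat μ)^[n + 1] (⊥ : Sub (rangeSub μ V).toMod) ≤ (Sub.sat μ)^[n] ⊥ := by
  have key : ∀ m, (Sub.sat μ)^[m + 1] (⊥ : Sub V) =
      ((Sub.sat μ)^[m] ⊥).comap (toRangeSub μ V) := fun m => by
    rw [Function.iterate_succ_apply, ← comap_toRangeSub_bot, sat_iterate_comap]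
  rw [key, key] at h
  intro X x hx
  obtain ⟨y, rfl⟩ := comp_toRangeSub_surjective μ X x
  exact h X hx

end Shift

/-! ### The double induction. -/

section Machinery

variable {P : CMod k C → Prop} {V W : CMod k C}

lemma finitelyGenerated_of_forall_eq_zero (hV : ∀ X (x : V.obj.obj X), x = 0) :
    V.FinitelyGenerated :=
  ⟨∅, Set.finite_empty, fun _ _ X => top_le_iff.1 fun x _ => hV X x ▸ zero_mem _⟩

/-- A property closed under extensions that holds for one zero object holds for all of them. -/
lemma ClosedUnderExtensions.of_forall_eq_zero (hP : ClosedUnderExtensions P) {Z : CMod k C}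
    (hZ : Limits.IsZero Z) (hPZ : P Z) (hV : ∀ X (x : V.obj.obj X), x = 0) : P V := by
  have hZ' := @eq_zero_of_isZero _ _ _ _ _ _ Z hZ
  have hfg := finitelyGenerated_of_forall_eq_zero (V := Z) fun _ => hZ'
  -- (P) is not assumed invariant under isomorphism, so `V` is reached through the exact sequence `0
  -- → Z → V → Z → 0`.
  refine hP Z V Z (hZ.to_ V) (hZ.from_ V) ⟨?_, ?_, ?_⟩ hfg
    (finitelyGenerated_of_forall_eq_zero hV) hfg hPZ hPZ
  · exact fun X x y _ => (hZ' x).trans (hZ' y).symm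
  · refine fun X => Submodule.ext fun x => ?_
    rw [hV X x]
    exact ⟨fun _ => zero_mem _, fun _ => zero_mem _⟩
  · exact fun X x => ⟨0, (hZ' _).trans (hZ' x).symm⟩

/-- The inductive machinery, for modules generated in degrees less than `d`. -/
lemma IsGeneric.property_of_genLT [IsNoetherianRing k] {deg : C ≃ ℕ} {ι : C ⥤ C} [ι.Additive]
    [Functor.Linear k ι] {μ : 𝟭 (CMod k C) ⟶ shift k ι} (hμ : IsGeneric μ deg)
    (hι : ∀ X : C, deg (ι.obj X) = deg X + 1) {Z : CMod k C} (hZ : Limits.IsZero Z) (hPZ : P Z)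
    (hdom : IsDominantOn FinitelyGenerated (shift k ι) P)
    (hpre : IsPredominantOn μ FinitelyGenerated (D μ) P) (hext : ClosedUnderExtensions P)
    {d : ℕ} (hV : ∀ X, Module.Finite k (V.obj.obj X)) (h : (⊤ : Sub V).GenLT deg d) : P V := by
  induction d generalizing V with
  | zero =>
    exact hext.of_forall_eq_zero hZ hPZ fun X x =>
      h (⊥ : Sub V) (fun Y hY => absurd hY (Nat.not_lt_zero _)) X (Submodule.mem_top (x := x))
  | succ d ih =>
    have hV' : ∀ X, IsNoetherian k (V.obj.obj X) := fun X => have := hV X; inferInstance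
    obtain ⟨n, hn⟩ := exists_sat_iterate_le μ hV' (hμ.isNoeth μ hι hV h) (⊥ : Sub V)
    clear hV'
    -- Inner induction on the stabilization index `n`, with `d` fixed; index 0 means `KV = 0`.
    induction n generalizing V with
    | zero =>
      refine hpre V (h.finitelyGenerated hV) (ih (finite_D μ hV) (hμ.genLT_D μ h)) fun X => ?_
      refine (Submodule.eq_bot_iff _).2 fun x hx => hn X ?_
      exact (comp_app μ X x).symm.trans hx
    | succ n ihn =>
      have hR : ∀ X, Module.Finite k ((rangeSub μ V).toMod.obj.obj X) := fun X =>
        have := hV X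
        Module.Finite.of_surjective _ (comp_toRangeSub_surjective μ X)
      have hR' := h.of_surjective _ (comp_toRangeSub_surjective μ)
      have hD := hμ.genLT_D μ h
      -- The image of `μ` has smaller index and `DV` a smaller degree bound.
      exact hdom V (h.finitelyGenerated hV) <| hext _ _ _ _ _ (isShortExact_rangeSub μ V)
        (hR'.finitelyGenerated hR) ((hμ.genLT_shift μ h).finitelyGenerated (finite_shift hV))
        (hD.finitelyGenerated (finite_D μ hV)) (ihn hR hR' (sat_iterate_toRangeSub μ hn))
        (ih (finite_D μ hV) hD)

end Machinery

end CMod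

theorem theorem1p2
    {k : Type w} [CommRing k] [IsNoetherianRing k]
    {C : Type u} [Category.{v} C] [Preadditive C] [Linear k C]
    (deg : C ≃ ℕ)
    (locally_finite : ∀ X Y : C, Module.Finite k (X ⟶ Y))
    (directed : ∀ (X Y : C) (f : X ⟶ Y), deg Y < deg X → f = 0)
    (ι : C ⥤ C) [ι.Additive] [Functor.Linear k ι] [ι.Faithful]
    (hι : ∀ X : C, deg (ι.obj X) = deg X + 1)
    (μ : 𝟭 (CMod k C) ⟶ CMod.shift k ι)
    (hμ : CMod.IsGeneric μ deg)
    (hS : ∀ s : C, ((CMod.shift k ι).obj (CMod.M k s)).FinitelyPresented)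
    (P : CMod k C → Prop)
    (Z : CMod k C) (hZ : Limits.IsZero Z) (hPZ : P Z) :
    (∀ V : CMod k C, V.FinitelyGenerated → P V) ↔
      (CMod.IsDominantOn CMod.FinitelyGenerated (CMod.shift k ι) P ∧
        CMod.IsPredominantOn μ CMod.FinitelyGenerated (CMod.D μ) P ∧
        CMod.ClosedUnderExtensions P) := by
  refine ⟨fun h => ⟨fun V hV _ => h V hV, fun V hV _ _ => h V hV,
    fun _ V _ _ _ _ _ hV _ _ _ => h V hV⟩, fun ⟨hdom, hpre, hext⟩ V hV => ?_⟩
  obtain ⟨d, hd⟩ := hV.exists_genLT deg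
  exact hμ.property_of_genLT hι hZ hPZ hdom hpre hext (hV.finite_obj locally_finite) hd
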